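/- Corollary 5.5 (Mielnik–Plebański–Strichartz formula). Let $B$ be a (not necessarily commutative) unital real Banach algebra, for example $\mathcal M_N(\mathbb C)$, and let $\mathcal A$ be the space of locally integrable functions $\mathbb R\to B$ (Bochner, Lebesgue measure). Put $R(f)(s):=\int_0^s f(u)\,du$, $f\prec g:=f\,R(g)$, $f\succ g:=R(f)\,g$ and $f*g:=f\prec g+f\succ g$. Extend these operations coefficientwise ($\lambda$-linearly) to formal series in $\lambda\mathcal A[[\lambda]]$, adjoin a unit $\mathbf 1$ for $*$, with $f\prec\mathbf 1=f$, and set $\log^*(\mathbf 1+x):=-\sum_{m>0}\frac{(-1)^m}{m}\,x^{*m}$ for $x\in\lambda\mathcal A[[\lambda]]$. Let $a\in\mathcal A$. The linear dendriform equation $X=\mathbf 1+\lambda a\prec X$ has exactly one solution $X$ in $\mathbb R\mathbf 1\oplus\lambda\mathcal A[[\lambda]]$. Let $\Omega'(\lambda a):=\log^*(X)$, and let $\Omega(\lambda a):=R(\Omega'(\lambda a))$ be the classical Magnus element. Then for every $s>0$, as formal power series in $\lambda$, $$\Omega(\lambda a)(s)=\sum_{n>0}\lambda^n\sum_{\sigma\in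 S_n}\frac{(-1)^{d(\sigma)}}{n\binom{n-1}{d(\sigma)}}\int\cdots\int_{0<u_n<\cdots<u_1<s}a(u_{\sigma_1})\cdots a(u_{\sigma_n})\,du_1\cdots du_n ,$$ where $d(\sigma)$ is the number of descents of $\sigma$, that is, of indices $1\le i\le n-1$ with $\sigma_i>\sigma_{i+1}$, and all the integrals converge absolutely. -/

import Mathlib

open MeasureTheory

namespace Magnus

/-! ### Dendriform algebras -/

/-- A dendriform algebra over a field `k`: a vector space with two bilinear operations `≺` (`prec`)
and `≻` (`succ`) satisfying the three dendriform axioms. -/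
class Dendriform (k D : Type*) [Field k] [AddCommGroup D] [Module k D] where
  prec : D →ₗ[k] D →ₗ[k] D
  succ : D →ₗ[k] D →ₗ[k] D
  prec_prec : ∀ a b c : D, prec (prec a b) c = prec a (prec b c + succ b c)
  succ_prec : ∀ a b c : D, prec (succ a b) c = succ a (prec b c)
  succ_succ : ∀ a b c : D, succ a (succ b c) = succ (prec a b + succ a b) c

section Dendriform

variable (k : Type*) {D : Type*} [Field k] [AddCommGroup D] [Module k D] [Dendriform k D]

/-- The associative product `x * y = x ≺ y + x ≻ y`. -/
def starMul (x y : D) : D := Dendriform.prec (k := k) x y + Dendriform.succ (k := k) x y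

/-- `starPow k x m` is the `(m + 1)`-st power `x * x * ⋯ * x` (`m + 1` factors). -/
def starPow (x : D) : ℕ → D
  | 0 => x
  | m + 1 => starMul k x (starPow x m)

/-- Elements of the unital augmentation `k 𝟏 ⊕ D` are pairs `(c, x)`, standing for `c 𝟏 + x`.
This is `a ≺ (c 𝟏 + x) = c a + a ≺ x`, for `a` in `D` (recall `a ≺ 𝟏 = a`). -/
def precAug (a : D) (X : k × D) : D := X.1 • a + Dendriform.prec (k := k) a X.2

/-- `X` solves the linear dendriform equation `X = 𝟏 + a ≺ X` in `k 𝟏 ⊕ D`. -/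
def IsSolution (a : D) (X : k × D) : Prop := X = (1, precAug k a X)

end Dendriform

/-! ### Formal series with coefficients in a dendriform algebra -/

/-- `λ D[[λ]]`: the formal series `∑_{n ≥ 1} x_n λ ^ n`, as sequences with vanishing `0`-th term. -/
def FormalSeries (k D : Type*) [Field k] [AddCommGroup D] [Module k D] :
    Submodule k (ℕ → D) where
  carrier := {x | x 0 = 0}
  add_mem' := by
    intro x y hx hy
    simp only [Set.mem_ofPred_eq] at hx hy
    simp [hx, hy]
  zero_mem' := rfl
  smul_mem' := by
    intro c x hx
    simp only [Set.mem_ofPred_eq] at hx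
    simp [hx]

namespace FormalSeries

variable {k D E : Type*} [Field k] [AddCommGroup D] [Module k D] [AddCommGroup E] [Module k E]

/-- The `λ`-bilinear extension of a bilinear operation (Cauchy product). -/
def cauchy (p : D →ₗ[k] D →ₗ[k] D) :
    FormalSeries k D →ₗ[k] FormalSeries k D →ₗ[k] FormalSeries k D :=
  LinearMap.mk₂ k
    (fun x y => ⟨fun n => ∑ ij ∈ Finset.HasAntidiagonal.antidiagonal n, p (x.1 ij.1) (y.1 ij.2), by
      have hx : x.1 0 = 0 := x.2
      change ∑ ij ∈ Finset.HasAntidiagonal.antidiagonal 0, p (x.1 ij.1) (y.1 ij.2) = 0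
      simp [hx]⟩)
    (by intro x x' y; ext n; simp [Finset.sum_add_distrib])
    (by intro c x y; ext n; simp [Finset.smul_sum])
    (by intro x y y'; ext n; simp [Finset.sum_add_distrib])
    (by intro c x y; ext n; simp [Finset.smul_sum])

theorem cauchy_coeff (p : D →ₗ[k] D →ₗ[k] D) (x y : FormalSeries k D) (n : ℕ) :
    (cauchy p x y).1 n = ∑ ij ∈ Finset.HasAntidiagonal.antidiagonal n, p (x.1 ij.1) (y.1 ij.2) := rfl

theorem cauchy_assoc (p q p' q' : D →ₗ[k] D →ₗ[k] D)
    (h : ∀ a b c, p (q a b) c = p' a (q' b c)) (x y z : FormalSeries k D) :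
    cauchy p (cauchy q x y) z = cauchy p' x (cauchy q' y z) := by
  ext n
  simp only [cauchy_coeff, map_sum, LinearMap.sum_apply, Finset.sum_sigma', h]
  apply Finset.sum_nbij' (fun ⟨⟨_i, j⟩, ⟨k, l⟩⟩ ↦ ⟨(k, l + j), (l, j)⟩)
    (fun ⟨⟨i, _j⟩, ⟨k, l⟩⟩ ↦ ⟨(i + k, l), (i, k)⟩) <;>
    simp +contextual [← add_assoc]
  rintro ⟨⟨i, j⟩, ⟨k, l⟩⟩ h1 h2
  simp only at h1 h2 ⊢
  omega

theorem cauchy_add (p q : D →ₗ[k] D →ₗ[k] D) (x y : FormalSeries k D) :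
    cauchy (p + q) x y = cauchy p x y + cauchy q x y := by
  ext n
  simp [cauchy_coeff, Finset.sum_add_distrib]

instance [Dendriform k D] : Dendriform k (FormalSeries k D) where
  prec := cauchy Dendriform.prec
  succ := cauchy Dendriform.succ
  prec_prec x y z := by
    rw [← cauchy_add]
    exact cauchy_assoc _ _ _ _ (fun a b c => Dendriform.prec_prec a b c) x y z
  succ_prec x y z :=
    cauchy_assoc _ _ _ _ (fun a b c => Dendriform.succ_prec a b c) x y z
  succ_succ x y z := by
    rw [← cauchy_add]
    exact (cauchy_assoc _ _ _ _ (fun a b c => (Dendriform.succ_succ a b c).symm) x y z).symm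

variable (k) in
/-- The series `λ a`. -/
def lam (a : D) : FormalSeries k D :=
  ⟨fun n => if n = 1 then a else 0, by change (if (0 : ℕ) = 1 then a else 0) = 0; simp⟩

/-- The coefficientwise extension of a linear map. -/
def map (f : D →ₗ[k] E) (x : FormalSeries k D) : FormalSeries k E :=
  ⟨fun n => f (x.1 n), by
    have hx : x.1 0 = 0 := x.2
    change f (x.1 0) = 0
    simp [hx]⟩

/-- The power `x ^ {* (m + 1)}` has no terms of degree `≤ m`. -/
theorem starPow_coeff_eq_zero [Dendriform k D] (x : FormalSeries k D) (m n : ℕ) (h : n ≤ m) :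
    (starPow k x m).1 n = 0 := by
  have hx : x.1 0 = 0 := x.2
  induction m generalizing n with
  | zero => obtain rfl : n = 0 := by omega
            exact hx
  | succ m ih =>
    have key : ∀ p : D →ₗ[k] D →ₗ[k] D, (cauchy p x (starPow k x m)).1 n = 0 := by
      intro p
      rw [cauchy_coeff]
      refine Finset.sum_eq_zero fun ij hij => ?_
      rw [Finset.HasAntidiagonal.mem_antidiagonal] at hij
      rcases Nat.eq_zero_or_pos ij.1 with h0 | h0
      · simp [h0, hx]
      · rw [ih ij.2 (by omega), map_zero]
    change (cauchy Dendriform.prec x (starPow k x m)).1 n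
      + (cauchy Dendriform.succ x (starPow k x m)).1 n = 0
    rw [key, key, add_zero]

/-- `log^* (𝟏 + x) = - ∑_{m ≥ 1} (-1) ^ m x ^ {* m} / m` for `x ∈ λ D[[λ]]`. The coefficient of
`λ ^ n` involves the terms `m ≤ n` only, because `x ^ {* m}` starts in degree `m`. Below, `m + 1`
is written for the summation index `m` of the formula. -/
def logStar [CharZero k] [Dendriform k D] (X : k × FormalSeries k D) : FormalSeries k D :=
  ⟨fun n => -∑ m ∈ Finset.range n, ((-1 : k) ^ (m + 1) / ((m + 1 : ℕ) : k)) • (starPow k X.2 m).1 n,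
    by change -∑ m ∈ Finset.range 0, _ = (0 : D); simp⟩

end FormalSeries

/-! ### Locally integrable functions of one real variable -/

section LocInt

theorem loc_int {B : Type*} [NormedRing B] {f : ℝ → B} (hf : LocallyIntegrable f volume) (x y : ℝ) :
    IntervalIntegrable f volume x y :=
  intervalIntegrable_iff.2 ((hf.integrableOn_isCompact isCompact_uIcc).mono_set
    Set.uIoc_subset_uIcc)

variable (B : Type*) [NormedRing B] [NormedAlgebra ℝ B]

/-- The space of locally integrable functions `ℝ → B`. -/
def LocInt : Submodule ℝ (ℝ → B) where
  carrier := {f | LocallyIntegrable f volume}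
  add_mem' := fun hf hg => LocallyIntegrable.add hf hg
  zero_mem' := locallyIntegrable_zero
  smul_mem' := fun c _ hf => LocallyIntegrable.smul hf c

variable {B}

theorem LocInt.continuous_primitive (f : LocInt B) :
    Continuous fun s => ∫ u in (0 : ℝ)..s, f.1 u :=
  intervalIntegral.continuous_primitive (loc_int f.2) 0

/-- The Rota--Baxter operator `(R a)(s) = ∫_0^s a(u) du`. -/
noncomputable def R : LocInt B →ₗ[ℝ] LocInt B where
  toFun f := ⟨fun s => ∫ u in (0 : ℝ)..s, f.1 u, (LocInt.continuous_primitive f).locallyIntegrable⟩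
  map_add' f g := by
    ext s
    exact intervalIntegral.integral_add ((loc_int f.2) 0 s) ((loc_int g.2) 0 s)
  map_smul' c f := by
    ext s
    exact intervalIntegral.integral_smul c f.1

theorem R_apply (f : LocInt B) (s : ℝ) : (R f).1 s = ∫ u in (0 : ℝ)..s, f.1 u := rfl

theorem R_continuous (f : LocInt B) : Continuous (R f).1 := (LocInt.continuous_primitive f)

theorem locInt_mul_continuous (f : LocInt B) {g : ℝ → B} (hg : Continuous g) :
    (fun s => f.1 s * g s) ∈ LocInt B :=
  locallyIntegrable_iff.2 fun _ hK =>
    (LocallyIntegrable.integrableOn_isCompact f.2 hK).mul_continuousOn hg.continuousOn hK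

theorem continuous_mul_locInt (f : LocInt B) {g : ℝ → B} (hg : Continuous g) :
    (fun s => g s * f.1 s) ∈ LocInt B :=
  locallyIntegrable_iff.2 fun _ hK =>
    (LocallyIntegrable.integrableOn_isCompact f.2 hK).continuousOn_mul hg.continuousOn hK

/-- `(f ≺ g)(s) = f(s) ∫_0^s g(u) du`. -/
noncomputable def locPrec : LocInt B →ₗ[ℝ] LocInt B →ₗ[ℝ] LocInt B :=
  LinearMap.mk₂ ℝ (fun f g => ⟨fun s => f.1 s * (R g).1 s, locInt_mul_continuous f (R_continuous g)⟩)
    (by intro f f' g; ext s; simp [add_mul])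
    (by intro c f g; ext s; simp)
    (by intro f g g'; ext s; simp [mul_add])
    (by intro c f g; ext s; simp)

/-- `(f ≻ g)(s) = (∫_0^s f(u) du) g(s)`. -/
noncomputable def locSucc : LocInt B →ₗ[ℝ] LocInt B →ₗ[ℝ] LocInt B :=
  LinearMap.mk₂ ℝ (fun f g => ⟨fun s => (R f).1 s * g.1 s, continuous_mul_locInt g (R_continuous f)⟩)
    (by intro f f' g; ext s; simp [add_mul])
    (by intro c f g; ext s; simp)
    (by intro f g g'; ext s; simp [mul_add])
    (by intro c f g; ext s; simp)

/-- Integration by parts on `[0, s]` with `0 ≤ s`. -/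
theorem integral_mul_integral_of_nonneg [CompleteSpace B] {f g : ℝ → B}
    (hf : LocallyIntegrable f volume) (hg : LocallyIntegrable g volume) {s : ℝ} (hs : 0 ≤ s) :
    (∫ u in (0 : ℝ)..s, f u) * (∫ u in (0 : ℝ)..s, g u)
      = (∫ u in (0 : ℝ)..s, f u * ∫ v in (0 : ℝ)..u, g v)
        + ∫ u in (0 : ℝ)..s, (∫ v in (0 : ℝ)..u, f v) * g u := by
  have hF : Integrable f (volume.restrict (Set.Ioc 0 s)) :=
    (intervalIntegrable_iff_integrableOn_Ioc_of_le hs).1 (loc_int hf _ _)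
  have hG : Integrable g (volume.restrict (Set.Ioc 0 s)) :=
    (intervalIntegrable_iff_integrableOn_Ioc_of_le hs).1 (loc_int hg _ _)
  have hFG := hF.mul_prod hG
  have hT : MeasurableSet {z : ℝ × ℝ | z.2 ≤ z.1} := measurableSet_le measurable_snd measurable_fst
  have h0 := integral_prod_bilin (ContinuousLinearMap.mul ℝ B) hF hG
  simp only [ContinuousLinearMap.mul_apply'] at h0
  rw [intervalIntegral.integral_of_le hs, intervalIntegral.integral_of_le hs, ← h0,
    ← integral_add_compl hT hFG, ← integral_indicator hT, ← integral_indicator hT.compl,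
    integral_prod _ (hFG.indicator hT), integral_prod_symm _ (hFG.indicator hT.compl),
    intervalIntegral.integral_of_le hs, intervalIntegral.integral_of_le hs]
  congr 1
  · refine setIntegral_congr_fun measurableSet_Ioc fun u hu => ?_
    have h1 : ∀ v, Set.indicator {z : ℝ × ℝ | z.2 ≤ z.1} (fun z => f z.1 * g z.2) (u, v)
        = Set.indicator (Set.Iic u) (fun v => f u * g v) v := by
      intro v; simp [Set.indicator]
    simp only [h1]
    rw [setIntegral_indicator measurableSet_Iic, Set.Ioc_inter_Iic, min_eq_right hu.2,
      intervalIntegral.integral_of_le hu.1.le]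
    have hgu : Integrable g (volume.restrict (Set.Ioc 0 u)) :=
      (intervalIntegrable_iff_integrableOn_Ioc_of_le hu.1.le).1 (loc_int hg _ _)
    exact ContinuousLinearMap.integral_comp_comm (ContinuousLinearMap.mul ℝ B (f u)) hgu
  · refine setIntegral_congr_fun measurableSet_Ioc fun v hv => ?_
    have h1 : ∀ u, Set.indicator {z : ℝ × ℝ | z.2 ≤ z.1}ᶜ (fun z => f z.1 * g z.2) (u, v)
        = Set.indicator (Set.Iio v) (fun u => f u * g v) u := by
      intro v; simp [Set.indicator]
    simp only [h1]
    rw [setIntegral_indicator measurableSet_Iio, intervalIntegral.integral_of_le hv.1.le]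
    have h2 : Set.Ioc 0 s ∩ Set.Iio v = Set.Ioo 0 v := by
      ext u; simp only [Set.mem_inter_iff, Set.mem_Ioc, Set.mem_Iio, Set.mem_Ioo]
      have := hv.2
      constructor
      · rintro ⟨⟨h, -⟩, h'⟩; exact ⟨h, h'⟩
      · rintro ⟨h, h'⟩; exact ⟨⟨h, by linarith⟩, h'⟩
    have hfv : Integrable f (volume.restrict (Set.Ioc 0 v)) :=
      (intervalIntegrable_iff_integrableOn_Ioc_of_le hv.1.le).1 (loc_int hf _ _)
    rw [h2, ← integral_Ioc_eq_integral_Ioo]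
    exact ContinuousLinearMap.integral_comp_comm ((ContinuousLinearMap.mul ℝ B).flip (g v)) hfv

/-- The Rota--Baxter relation of weight zero: `R(f) R(g) = R(f ≺ g + f ≻ g)`. -/
theorem R_mul_R [CompleteSpace B] (f g : LocInt B) (s : ℝ) :
    (R f).1 s * (R g).1 s = (R (locPrec f g + locSucc f g)).1 s := by
  rw [map_add]
  change (∫ u in (0 : ℝ)..s, f.1 u) * (∫ u in (0 : ℝ)..s, g.1 u)
      = (∫ u in (0 : ℝ)..s, f.1 u * ∫ v in (0 : ℝ)..u, g.1 v)
        + ∫ u in (0 : ℝ)..s, (∫ v in (0 : ℝ)..u, f.1 v) * g.1 u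
  rcases le_total 0 s with hs | hs
  · exact integral_mul_integral_of_nonneg f.2 g.2 hs
  · have hneg : ∀ h : LocInt B, LocallyIntegrable (fun x => h.1 (-x)) volume := fun h =>
      locallyIntegrable_iff.2 fun K hK => by
        have h1 := LocallyIntegrable.integrableOn_isCompact h.2 hK.neg
        have h2 := (Measure.measurePreserving_neg (volume : Measure ℝ)).integrableOn_comp_preimage
          (Homeomorph.neg ℝ).measurableEmbedding (f := h.1) (s := -K)
        have h3 := h2.2 h1
        simpa [Function.comp_def] using h3
    have hint : ∀ (h : ℝ → B) (t : ℝ), ∫ u in (0 : ℝ)..t, h (-u) = -∫ u in (0 : ℝ)..(-t), h u := by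
      intro h t
      rw [intervalIntegral.integral_comp_neg, neg_zero, intervalIntegral.integral_symm]
    have key := integral_mul_integral_of_nonneg (hneg f) (hneg g) (s := -s) (by linarith)
    simp only [hint, neg_neg, neg_mul, mul_neg, intervalIntegral.integral_neg] at key
    rw [hint (fun u => f.1 u * ∫ v in (0 : ℝ)..u, g.1 v),
      hint (fun u => (∫ v in (0 : ℝ)..u, f.1 v) * g.1 u)] at key
    simpa using key

/-- The dendriform algebra of locally integrable functions. -/
noncomputable instance [CompleteSpace B] : Dendriform ℝ (LocInt B) where
  prec := locPrec
  succ := locSucc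
  prec_prec f g h := by
    ext s
    change f.1 s * (R g).1 s * (R h).1 s = f.1 s * (R (locPrec g h + locSucc g h)).1 s
    rw [mul_assoc, R_mul_R]
  succ_prec f g h := by
    ext s
    change (R f).1 s * g.1 s * (R h).1 s = (R f).1 s * (g.1 s * (R h).1 s)
    rw [mul_assoc]
  succ_succ f g h := by
    ext s
    change (R f).1 s * ((R g).1 s * h.1 s) = (R (locPrec f g + locSucc f g)).1 s * h.1 s
    rw [← mul_assoc, R_mul_R]

end LocInt

/-! ### Permutations and simplices -/

/-- The number of descents of `σ ∈ S_n`: positions `i` such that `σ (i) > σ (i + 1)`. -/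
def descents {n : ℕ} (σ : Equiv.Perm (Fin n)) : ℕ :=
  (Finset.univ.filter fun i : Fin n =>
    ∃ h : (i : ℕ) + 1 < n, σ ⟨(i : ℕ) + 1, h⟩ < σ i).card

/-- The simplex `0 < u_n < ⋯ < u_1 < s`. -/
def simplex (n : ℕ) (s : ℝ) : Set (Fin n → ℝ) :=
  {u | (∀ i, 0 < u i ∧ u i < s) ∧ ∀ i j, i < j → u j < u i}

/-- The ordered product `a(u_{σ_1}) a(u_{σ_2}) ⋯ a(u_{σ_n})`. -/
def orderedProd {B : Type*} [Monoid B] (a : ℝ → B) {n : ℕ} (σ : Equiv.Perm (Fin n))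
    (u : Fin n → ℝ) : B :=
  (List.ofFn fun i => a (u (σ i))).prod

end Magnus

/-! Write the solution as `𝟏 + X'`. Since `∫_{-1}^0 x^m dx = -(-1)^(m+1)/(m+1)`, the series `log^*(𝟏
+ X')` is the integral over `x ∈ [-1, 0]` of the geometric series `∑ x^m X'^{*(m+1)}`, a finite sum
in each degree. As `R` turns `*` into the pointwise product, `Ω(s)` is the integral over `x` of `W =
Y + x Y² + ⋯`, where `Y = R(X')(s)` and `W = Y + x Y W` (`powerSum_eq`, `map_R_logStar`).

Put `F(t) = 1 + R(X')(t)`, so that `F(t) = 1 + λ ∫_0^t a F`, and let `P(t) = F(t) (1 + x W)`, whose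
coefficients are `dysonConv`. Then `W = Y (1 + x W) = λ ∫_0^s a P`, whence `P(t) = 1 + λ ∫_0^s ([v <
t] + x) a(v) P(v) dv`. Iterating this kernel writes the coefficient of `λ^n` in `W` as an integral
of `a(u_1) ⋯ a(u_n)` over the cube `(0, s)^n`, with weight `∏ (x + [u_{i+1} < u_i])`
(`eq_integral_chainWeight`).

Up to a null set the cube is a disjoint union of `n!` permuted simplices (`integral_cube_eq_sum`).
On the piece indexed by `σ` the weight is the constant `x^d (1+x)^(n-1-d)` with `d = d(σ)`
(`chainWeight_comp_perm`), and a Beta integral over `[-1, 0]` turns it into the stated coefficient.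
-/

namespace Magnus

/-! ### Weighted iterated integrals over a cube -/

section Words

variable {B : Type*} [NormedRing B]

/-- The product `a(u_0) a(u_1) ⋯ a(u_{n-1})`. -/
def wordProd {B : Type*} [Monoid B] (a : ℝ → B) {n : ℕ} (u : Fin n → ℝ) : B :=
  (List.ofFn fun i => a (u i)).prod

theorem wordProd_zero (a : ℝ → B) (u : Fin 0 → ℝ) : wordProd a u = 1 := by
  simp [wordProd]

theorem wordProd_cons (a : ℝ → B) {n : ℕ} (v : ℝ) (u : Fin n → ℝ) :
    wordProd a (Fin.cons v u : Fin (n + 1) → ℝ) = a v * wordProd a u := by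
  simp [wordProd, List.ofFn_succ]

theorem wordProd_comp_perm (a : ℝ → B) {n : ℕ} (σ : Equiv.Perm (Fin n)) (u : Fin n → ℝ) :
    wordProd a (u ∘ σ) = orderedProd a σ u := rfl

/-- The weight `∏ (x + [u_{i+1} < u_i])` of a sequence `u_0, …, u_n`. -/
noncomputable def chainWeight (x : ℝ) {n : ℕ} (u : Fin (n + 1) → ℝ) : ℝ :=
  ∏ i : Fin n, if u i.succ < u i.castSucc then 1 + x else x

theorem chainWeight_zero (x : ℝ) (u : Fin 1 → ℝ) : chainWeight x u = 1 := by
  simp [chainWeight]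

theorem chainWeight_cons_cons (x t v : ℝ) {n : ℕ} (u : Fin n → ℝ) :
    chainWeight x (Fin.cons t (Fin.cons v u : Fin (n + 1) → ℝ) : Fin (n + 2) → ℝ)
      = (if v < t then 1 + x else x) * chainWeight x (Fin.cons v u : Fin (n + 1) → ℝ) := by
  simp only [chainWeight]
  rw [Fin.prod_univ_succ]
  simp only [← Fin.succ_castSucc, Fin.cons_succ, Fin.castSucc_zero, Fin.cons_zero]

theorem measurable_chainWeight (x : ℝ) (n : ℕ) :
    Measurable fun u : Fin (n + 1) → ℝ => chainWeight x u := by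
  refine Finset.measurable_prod _ fun i _ => ?_
  exact Measurable.ite (measurableSet_lt (measurable_pi_apply _) (measurable_pi_apply _))
    measurable_const measurable_const

theorem norm_chainWeight_le (x : ℝ) {n : ℕ} (u : Fin (n + 1) → ℝ) :
    ‖chainWeight x u‖ ≤ (1 + |x|) ^ n := by
  rw [chainWeight, norm_prod]
  calc ∏ i : Fin n, ‖if u i.succ < u i.castSucc then 1 + x else x‖
      ≤ ∏ _i : Fin n, (1 + |x|) := by
        refine Finset.prod_le_prod (fun _ _ => norm_nonneg _) fun i _ => ?_
        split_ifs
        · simpa using abs_add_le 1 x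
        · simp
    _ = (1 + |x|) ^ n := by simp

/-- Lebesgue measure on the cube `(0, s) ^ n`. -/
noncomputable def cubeMeasure (n : ℕ) (s : ℝ) : Measure (Fin n → ℝ) :=
  Measure.pi fun _ => volume.restrict (Set.Ioo 0 s)

instance (n : ℕ) (s : ℝ) : IsFiniteMeasure (cubeMeasure n s) := by
  unfold cubeMeasure
  infer_instance

theorem cubeMeasure_eq_restrict (n : ℕ) (s : ℝ) :
    cubeMeasure n s = volume.restrict (Set.univ.pi fun _ => Set.Ioo 0 s) :=
  (Measure.restrict_pi_pi _ _).symm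

/-- Splitting off the first coordinate preserves the measure of the cube. -/
theorem measurePreserving_cube (n : ℕ) (s : ℝ) :
    MeasurePreserving (MeasurableEquiv.piFinSuccAbove (fun _ : Fin (n + 1) => ℝ) 0)
      (cubeMeasure (n + 1) s) ((volume.restrict (Set.Ioo 0 s)).prod (cubeMeasure n s)) :=
  measurePreserving_piFinSuccAbove (fun _ => volume.restrict (Set.Ioo 0 s)) 0

theorem piFinSuccAbove_zero_symm_apply (n : ℕ) (p : ℝ × (Fin n → ℝ)) :
    (MeasurableEquiv.piFinSuccAbove (fun _ : Fin (n + 1) => ℝ) 0).symm p = Fin.cons p.1 p.2 := by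
  simp [MeasurableEquiv.piFinSuccAbove, Fin.insertNthEquiv]

theorem integrable_cube_succ_iff {n : ℕ} {s : ℝ} {f : (Fin (n + 1) → ℝ) → B} :
    Integrable f (cubeMeasure (n + 1) s) ↔
      Integrable (fun p : ℝ × (Fin n → ℝ) => f (Fin.cons p.1 p.2))
        ((volume.restrict (Set.Ioo 0 s)).prod (cubeMeasure n s)) := by
  rw [← (measurePreserving_cube n s).symm.integrable_comp_emb (MeasurableEquiv.measurableEmbedding _)]
  simp only [Function.comp_def, piFinSuccAbove_zero_symm_apply]

/-- The factors depend on separate variables, so the product is integrable on the product space. All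
absolute convergence below comes from this. -/
theorem integrable_wordProd {a : ℝ → B} (ha : LocallyIntegrable a volume) (n : ℕ) (s : ℝ) :
    Integrable (fun u : Fin n → ℝ => wordProd a u) (cubeMeasure n s) := by
  have ha' : Integrable a (volume.restrict (Set.Ioo 0 s)) :=
    (ha.integrableOn_isCompact isCompact_Icc).mono_set Set.Ioo_subset_Icc_self
  induction n with
  | zero => simp only [wordProd_zero]; exact integrable_const _
  | succ n ih =>
    rw [integrable_cube_succ_iff]
    simp only [wordProd_cons]
    exact ha'.mul_prod ih

variable [NormedAlgebra ℝ B]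

theorem integral_cube_succ {n : ℕ} {s : ℝ} {f : (Fin (n + 1) → ℝ) → B}
    (hf : Integrable f (cubeMeasure (n + 1) s)) :
    ∫ u, f u ∂cubeMeasure (n + 1) s =
      ∫ v in Set.Ioo 0 s, ∫ u, f (Fin.cons v u) ∂cubeMeasure n s := by
  rw [← (measurePreserving_cube n s).symm.integral_comp' f]
  simp only [piFinSuccAbove_zero_symm_apply]
  exact integral_prod _ (integrable_cube_succ_iff.1 hf)

theorem integrable_chainWeight_smul {a : ℝ → B} (ha : LocallyIntegrable a volume) (x : ℝ) (n : ℕ)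
    (s : ℝ) : Integrable (fun u : Fin (n + 1) → ℝ => chainWeight x u • wordProd a u)
      (cubeMeasure (n + 1) s) :=
  (integrable_wordProd ha (n + 1) s).bdd_smul _ (measurable_chainWeight x n).aestronglyMeasurable
    (Filter.Eventually.of_forall fun u => norm_chainWeight_le x u)

theorem integrable_chainWeight_cons_smul {a : ℝ → B} (ha : LocallyIntegrable a volume) (x t : ℝ)
    (n : ℕ) (s : ℝ) :
    Integrable (fun u : Fin n → ℝ => chainWeight x (Fin.cons t u : Fin (n + 1) → ℝ) • wordProd a u)
      (cubeMeasure n s) := by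
  refine (integrable_wordProd ha n s).bdd_smul _ (Measurable.aestronglyMeasurable ?_)
    (Filter.Eventually.of_forall fun u => norm_chainWeight_le x _)
  refine (measurable_chainWeight x n).comp (measurable_pi_iff.2 fun i => ?_)
  refine Fin.cases ?_ (fun j => ?_) i
  · simp
  · simpa using measurable_pi_apply j

theorem integral_chainWeight_smul_succ [CompleteSpace B] {a : ℝ → B}
    (ha : LocallyIntegrable a volume)
    (x : ℝ) (n : ℕ) (s : ℝ) :
    ∫ u : Fin (n + 1) → ℝ, chainWeight x u • wordProd a u ∂cubeMeasure (n + 1) s =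
      ∫ v in Set.Ioo 0 s, a v * ∫ u : Fin n → ℝ,
        chainWeight x (Fin.cons v u : Fin (n + 1) → ℝ) • wordProd a u ∂cubeMeasure n s := by
  rw [integral_cube_succ (integrable_chainWeight_smul ha x n s)]
  refine integral_congr_ae (Filter.Eventually.of_forall fun v => ?_)
  simp only [wordProd_cons, ← mul_smul_comm]
  exact ContinuousLinearMap.integral_comp_comm (ContinuousLinearMap.mul ℝ B (a v))
    (integrable_chainWeight_cons_smul ha x v n s)

theorem integral_chainWeight_cons_smul_succ [CompleteSpace B] {a : ℝ → B}
    (ha : LocallyIntegrable a volume)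
    (x t : ℝ) (n : ℕ) (s : ℝ) :
    ∫ u : Fin (n + 1) → ℝ, chainWeight x (Fin.cons t u : Fin (n + 2) → ℝ) • wordProd a u
        ∂cubeMeasure (n + 1) s =
      ∫ v in Set.Ioo 0 s, (if v < t then 1 + x else x) • (a v * ∫ u : Fin n → ℝ,
        chainWeight x (Fin.cons v u : Fin (n + 1) → ℝ) • wordProd a u ∂cubeMeasure n s) := by
  rw [integral_cube_succ (integrable_chainWeight_cons_smul ha x t (n + 1) s)]
  refine integral_congr_ae (Filter.Eventually.of_forall fun v => ?_)
  simp only [wordProd_cons, chainWeight_cons_cons, mul_smul]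
  rw [integral_smul]
  congr 1
  simp only [← mul_smul_comm]
  exact ContinuousLinearMap.integral_comp_comm (ContinuousLinearMap.mul ℝ B (a v))
    (integrable_chainWeight_cons_smul ha x v n s)

/-- A solution of the recursion `P_{n+1}(t) = ∫_0^t a P_n + x ∫_0^s a P_n` is an integral over the
cube. -/
theorem eq_integral_chainWeight [CompleteSpace B] {a : ℝ → B} (ha : LocallyIntegrable a volume)
    (x s : ℝ) (P : ℕ → ℝ → B) (hc : ∀ n, Continuous (P n)) (h0 : ∀ t, P 0 t = 1)
    (hP : ∀ n t, P (n + 1) t = (∫ v in (0 : ℝ)..t, a v * P n v)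
      + x • ∫ v in (0 : ℝ)..s, a v * P n v) (n : ℕ) {t : ℝ} (ht : t ∈ Set.Icc 0 s) :
    P n t = ∫ u : Fin n → ℝ, chainWeight x (Fin.cons t u : Fin (n + 1) → ℝ) • wordProd a u
        ∂cubeMeasure n s := by
  induction n generalizing t with
  | zero => simp [h0, wordProd_zero, chainWeight_zero, cubeMeasure, measureReal_def, Measure.pi_empty_univ]
  | succ n ih =>
    have hint : LocallyIntegrable (fun v => a v * P n v) volume :=
      locInt_mul_continuous ⟨a, ha⟩ (hc n)
    have hs : 0 ≤ s := ht.1.trans ht.2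
    have hIoo : ∀ c, IntegrableOn (fun v => a v * P n v) (Set.Ioo 0 c) volume := fun c =>
      (hint.integrableOn_isCompact isCompact_Icc).mono_set Set.Ioo_subset_Icc_self
    have hsmul : Integrable (fun v => x • (a v * P n v)) (volume.restrict (Set.Ioo 0 s)) :=
      (hIoo s).smul x
    have hset : Set.Ioo 0 s ∩ Set.Iio t = Set.Ioo 0 t := by
      ext v
      simp only [Set.mem_inter_iff, Set.mem_Ioo, Set.mem_Iio]
      exact ⟨fun h => ⟨h.1.1, h.2⟩, fun h => ⟨⟨h.1, h.2.trans_le ht.2⟩, h.2⟩⟩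
    -- Inserting the indicator of `v < t` extends `∫_0^t` to `(0, s)`, so that both integrals merge
    -- into one with kernel `[v < t] + x`.
    rw [integral_chainWeight_cons_smul_succ ha, hP, intervalIntegral.integral_of_le ht.1,
      intervalIntegral.integral_of_le hs, integral_Ioc_eq_integral_Ioo,
      integral_Ioc_eq_integral_Ioo, ← hset, ← setIntegral_indicator measurableSet_Iio,
      ← integral_smul, ← integral_add ((hIoo s).indicator measurableSet_Iio) hsmul]
    refine setIntegral_congr_fun measurableSet_Ioo fun v hv => ?_
    simp only [← ih ⟨hv.1.le, hv.2.le⟩, Set.indicator, Set.mem_Iio]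
    split_ifs <;> simp [add_smul]

end Words

/-! ### Decomposition of the cube into simplices -/

section Cube

variable {B : Type*} [NormedRing B]

theorem measurableSet_simplex (n : ℕ) (s : ℝ) : MeasurableSet (simplex n s) := by
  simp only [simplex, Set.ofPred_and, Set.ofPred_forall]
  refine MeasurableSet.inter (MeasurableSet.iInter fun i => MeasurableSet.inter ?_ ?_)
    (MeasurableSet.iInter fun i => MeasurableSet.iInter fun j => MeasurableSet.iInter fun _ => ?_)
  · exact measurableSet_lt measurable_const (measurable_pi_apply i)
  · exact measurableSet_lt (measurable_pi_apply i) measurable_const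
  · exact measurableSet_lt (measurable_pi_apply j) (measurable_pi_apply i)

theorem coe_piCongrLeft_symm_perm {n : ℕ} (σ : Equiv.Perm (Fin n)) :
    ⇑(MeasurableEquiv.piCongrLeft (fun _ : Fin n => ℝ) σ.symm) = fun u => u ∘ σ := by
  ext u i
  simpa using MeasurableEquiv.piCongrLeft_apply_apply (β := fun _ => ℝ) σ.symm u (σ i)

/-- Permuting the coordinates preserves Lebesgue measure. -/
theorem measurePreserving_comp_perm {n : ℕ} (σ : Equiv.Perm (Fin n)) :
    MeasurePreserving (fun u : Fin n → ℝ => u ∘ σ) volume volume := by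
  rw [← coe_piCongrLeft_symm_perm]
  exact volume_measurePreserving_piCongrLeft (fun _ : Fin n => ℝ) σ.symm

theorem measurableEmbedding_comp_perm {n : ℕ} (σ : Equiv.Perm (Fin n)) :
    MeasurableEmbedding (fun u : Fin n → ℝ => u ∘ σ) := by
  rw [← coe_piCongrLeft_symm_perm]
  exact (MeasurableEquiv.piCongrLeft (fun _ : Fin n => ℝ) σ.symm).measurableEmbedding

/-- The diagonal is a proper linear subspace: the `i`-th basis vector lies outside it. -/
theorem volume_eq_coord_eq_zero {n : ℕ} {i j : Fin n} (h : i ≠ j) :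
    volume {u : Fin n → ℝ | u i = u j} = 0 := by
  let φ : (Fin n → ℝ) →ₗ[ℝ] ℝ := LinearMap.proj (R := ℝ) (φ := fun _ => ℝ) i - LinearMap.proj j
  have hφ : {u : Fin n → ℝ | u i = u j} = (LinearMap.ker φ : Set (Fin n → ℝ)) := by
    ext u
    simp [φ, sub_eq_zero]
  rw [hφ]
  refine Measure.addHaar_submodule _ _ fun htop => ?_
  have : (Pi.single i 1 : Fin n → ℝ) ∈ LinearMap.ker φ := htop ▸ Submodule.mem_top
  simp [φ, h.symm] at this

theorem ae_injective (n : ℕ) : ∀ᵐ u : Fin n → ℝ, Function.Injective u := by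
  have : ∀ᵐ u : Fin n → ℝ, ∀ i j : Fin n, i ≠ j → u i ≠ u j := by
    refine ae_all_iff.2 fun i => ae_all_iff.2 fun j => ?_
    by_cases h : i = j
    · simp [h]
    · simpa [h] using measure_eq_zero_iff_ae_notMem.1 (volume_eq_coord_eq_zero h)
  filter_upwards [this] with u hu i j hij
  by_contra h
  exact hu i j h hij

theorem mem_simplex_iff {n : ℕ} {s : ℝ} {u : Fin n → ℝ} :
    u ∈ simplex n s ↔ (∀ i, u i ∈ Set.Ioo 0 s) ∧ StrictAnti u :=
  Iff.rfl.and ⟨fun h _ _ hij => h _ _ hij, fun h _ _ hij => h hij⟩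

/-- An injective sequence is strictly decreasing after some permutation. -/
theorem exists_strictAnti_comp_perm {n : ℕ} {u : Fin n → ℝ} (hu : Function.Injective u) :
    ∃ σ : Equiv.Perm (Fin n), StrictAnti (u ∘ σ) := by
  refine ⟨Tuple.sort fun i => -u i, ?_⟩
  have h := (Tuple.monotone_sort fun i => -u i).strictMono_of_injective
    ((neg_injective.comp hu).comp (Equiv.injective _))
  intro i j hij
  simpa using h hij

theorem cube_ae_eq_iUnion (n : ℕ) (s : ℝ) :
    (Set.univ.pi fun _ : Fin n => Set.Ioo 0 s) =ᵐ[volume]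
      ⋃ σ : Equiv.Perm (Fin n), (fun u : Fin n → ℝ => u ∘ σ) ⁻¹' simplex n s := by
  filter_upwards [ae_injective n] with u hu
  refine propext ?_
  change (u ∈ Set.univ.pi fun _ : Fin n => Set.Ioo 0 s) ↔
    u ∈ ⋃ σ : Equiv.Perm (Fin n), (fun u : Fin n → ℝ => u ∘ σ) ⁻¹' simplex n s
  simp only [Set.mem_pi, Set.mem_univ, true_implies, Set.mem_iUnion, Set.mem_preimage,
    mem_simplex_iff, Function.comp_apply]
  constructor
  · intro h
    obtain ⟨σ, hσ⟩ := exists_strictAnti_comp_perm hu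
    exact ⟨σ, fun i => h _, hσ⟩
  · rintro ⟨σ, h, -⟩ i
    simpa using h (σ.symm i)

/-- The decreasing rearrangement of a sequence is unique, and injectivity of the sequence then
determines the permutation. -/
theorem pairwise_disjoint_preimage_simplex (n : ℕ) (s : ℝ) :
    Pairwise (Function.onFun Disjoint
      fun σ : Equiv.Perm (Fin n) => (fun u : Fin n → ℝ => u ∘ σ) ⁻¹' simplex n s) := by
  intro σ τ hστ
  refine Set.disjoint_left.2 fun u hσ hτ => hστ ?_
  rw [Set.mem_preimage, mem_simplex_iff] at hσ hτ
  have h := Tuple.unique_antitone hσ.2.antitone hτ.2.antitone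
  have hu : Function.Injective u := by
    have := hσ.2.injective
    simpa [Function.Injective.of_comp_iff', Function.comp_assoc] using
      this.comp σ.symm.injective
  exact Equiv.ext fun i => hu (congrFun h i)

/-- An integral over the cube is a sum of `n!` integrals over the simplex. -/
theorem integral_cube_eq_sum [NormedAlgebra ℝ B] {n : ℕ} {s : ℝ} {f : (Fin n → ℝ) → B}
    (hf : Integrable f (cubeMeasure n s)) :
    ∫ u, f u ∂cubeMeasure n s =
      ∑ σ : Equiv.Perm (Fin n), ∫ u in simplex n s, f (u ∘ σ) := by
  rw [cubeMeasure_eq_restrict] at hf ⊢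
  rw [setIntegral_congr_set (cube_ae_eq_iUnion n s), integral_iUnion_fintype
    (fun σ => (measurePreserving_comp_perm σ).measurable (measurableSet_simplex n s))
    (pairwise_disjoint_preimage_simplex n s)]
  -- On the piece indexed by `σ`, the substitution `w = u ∘ σ` turns `f u` into `f (w ∘ σ⁻¹)`; hence
  -- the reindexing by inverses.
  · rw [← Equiv.sum_comp (Equiv.inv (Equiv.Perm (Fin n)))]
    refine Finset.sum_congr rfl fun σ _ => ?_
    rw [← (measurePreserving_comp_perm σ⁻¹).setIntegral_preimage_emb
      (measurableEmbedding_comp_perm σ⁻¹) (fun u => f (u ∘ σ))]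
    simp [Function.comp_assoc]
  · intro σ
    exact IntegrableOn.congr_set_ae hf (cube_ae_eq_iUnion n s).symm |>.mono_set
      (Set.subset_iUnion (fun σ : Equiv.Perm (Fin n) =>
        (fun u : Fin n → ℝ => u ∘ σ) ⁻¹' simplex n s) σ)

/-- Permuting coordinates preserves the measure, and the simplex lies in the preimage of the cube.
-/
theorem integrableOn_orderedProd {a : ℝ → B} (ha : LocallyIntegrable a volume) {n : ℕ} (s : ℝ)
    (σ : Equiv.Perm (Fin n)) : IntegrableOn (orderedProd a σ) (simplex n s) volume := by
  have h : IntegrableOn (fun u : Fin n → ℝ => wordProd a u)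
      (Set.univ.pi fun _ => Set.Ioo 0 s) volume := by
    have := integrable_wordProd ha n s
    rwa [cubeMeasure_eq_restrict] at this
  have h' := ((measurePreserving_comp_perm σ).integrableOn_comp_preimage
    (measurableEmbedding_comp_perm σ)).2 h
  exact h'.mono_set fun u hu i _ => (mem_simplex_iff.1 hu).1 (σ i)

end Cube

/-! ### Descents and the weight on a simplex -/

section Descents

theorem descents_succ_eq_card {n : ℕ} (σ : Equiv.Perm (Fin (n + 1))) :
    descents σ = (Finset.univ.filter fun i : Fin n => σ i.succ < σ i.castSucc).card := by
  -- The last index has no successor, so it is never a descent.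
  rw [descents, Fin.univ_castSuccEmb, Finset.filter_cons_of_neg, Finset.filter_map,
    Finset.card_map]
  · congr 1
    ext i
    simp
    rfl
  · simp

theorem descents_le {n : ℕ} (σ : Equiv.Perm (Fin (n + 1))) : descents σ ≤ n := by
  rw [descents_succ_eq_card]
  exact (Finset.card_filter_le _ _).trans (by simp)

/-- A decreasing `u` reverses comparisons, so each ascent of `σ` contributes `1 + x` and each
descent `x`. -/
theorem chainWeight_comp_perm {n : ℕ} (x : ℝ) {u : Fin (n + 1) → ℝ} (hu : StrictAnti u)
    (σ : Equiv.Perm (Fin (n + 1))) :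
    chainWeight x (u ∘ σ) = x ^ descents σ * (1 + x) ^ (n - descents σ) := by
  have h : ∀ i : Fin n, u (σ i.succ) < u (σ i.castSucc) ↔ ¬ σ i.succ < σ i.castSucc := by
    intro i
    rw [hu.lt_iff_gt, not_lt, le_iff_lt_or_eq, or_iff_left]
    exact fun h => (Fin.castSucc_lt_succ (i := i)).ne (σ.injective h)
  simp only [chainWeight, Function.comp_apply, h, ite_not]
  rw [Finset.prod_ite, Finset.prod_const, Finset.prod_const, ← descents_succ_eq_card]
  congr 2
  have := Finset.card_filter_add_card_filter_not (s := Finset.univ)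
    (fun i : Fin n => σ i.succ < σ i.castSucc)
  rw [← descents_succ_eq_card, Finset.card_univ, Fintype.card_fin] at this
  omega

theorem integral_chainWeight_eq_sum {B : Type*} [NormedRing B] [NormedAlgebra ℝ B] {a : ℝ → B}
    (ha : LocallyIntegrable a volume) (x : ℝ) (n : ℕ) (s : ℝ) :
    ∫ u : Fin (n + 1) → ℝ, chainWeight x u • wordProd a u ∂cubeMeasure (n + 1) s =
      ∑ σ : Equiv.Perm (Fin (n + 1)), (x ^ descents σ * (1 + x) ^ (n - descents σ)) •
        ∫ u in simplex (n + 1) s, orderedProd a σ u := by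
  rw [integral_cube_eq_sum (integrable_chainWeight_smul ha x n s)]
  refine Finset.sum_congr rfl fun σ _ => ?_
  rw [← integral_smul]
  refine setIntegral_congr_fun (measurableSet_simplex _ _) fun u hu => ?_
  simp only [chainWeight_comp_perm x (mem_simplex_iff.1 hu).2, wordProd_comp_perm]

end Descents

/-! ### Beta integrals on `[-1, 0]` -/

section Beta

theorem integral_pow_neg_one_zero (m : ℕ) :
    ∫ x in (-1 : ℝ)..0, x ^ m = -((-1 : ℝ) ^ (m + 1) / ((m + 1 : ℕ) : ℝ)) := by
  rw [integral_pow]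
  simp [neg_div]

/-- The combined integrand is the derivative of `x^(d+1) (1+x)^(e+1)`, which vanishes at both
endpoints. This drives the induction on `d`, with `e` free. -/
theorem integral_pow_mul_one_add_pow_succ (d e : ℕ) :
    ((d : ℝ) + 1) * (∫ x in (-1 : ℝ)..0, x ^ d * (1 + x) ^ (e + 1))
      + ((e : ℝ) + 1) * (∫ x in (-1 : ℝ)..0, x ^ (d + 1) * (1 + x) ^ e) = 0 := by
  have hderiv : ∀ x ∈ Set.uIcc (-1 : ℝ) 0, HasDerivAt (fun x : ℝ => x ^ (d + 1) * (1 + x) ^ (e + 1))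
      (((d : ℝ) + 1) * (x ^ d * (1 + x) ^ (e + 1))
        + ((e : ℝ) + 1) * (x ^ (d + 1) * (1 + x) ^ e)) x := by
    intro x _
    refine ((hasDerivAt_pow (d + 1) x).mul
      (((hasDerivAt_id x).const_add 1).pow (e + 1))).congr_deriv ?_
    simp
    ring
  have hc : ∀ f : ℝ → ℝ, Continuous f → IntervalIntegrable f volume (-1) 0 :=
    fun f hf => hf.intervalIntegrable _ _
  have h := intervalIntegral.integral_eq_sub_of_hasDerivAt hderiv (hc _ (by fun_prop))
  rw [intervalIntegral.integral_add (hc _ (by fun_prop)) (hc _ (by fun_prop)),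
    intervalIntegral.integral_const_mul, intervalIntegral.integral_const_mul] at h
  simpa using h

theorem integral_pow_mul_one_add_pow (d e : ℕ) :
    ∫ x in (-1 : ℝ)..0, x ^ d * (1 + x) ^ e =
      (-1 : ℝ) ^ d / (((d + e + 1 : ℕ) : ℝ) * ((d + e).choose d : ℝ)) := by
  induction d generalizing e with
  | zero =>
    have := intervalIntegral.integral_comp_add_left (fun x : ℝ => x ^ e) (1 : ℝ) (a := -1) (b := 0)
    simp [this, integral_pow]
  | succ d ih =>
    have h := integral_pow_mul_one_add_pow_succ d e
    rw [ih (e + 1)] at h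
    have hch : ((d + 1 + e).choose (d + 1) : ℝ) * (d + 1) =
        ((d + (e + 1)).choose d : ℝ) * (e + 1) := by
      have := Nat.choose_succ_right_eq (d + 1 + e) d
      rw [show d + (e + 1) = d + 1 + e by ring]
      rw [show d + 1 + e - d = e + 1 by omega] at this
      exact_mod_cast this
    have h1 : ((d + 1 + e).choose (d + 1) : ℝ) ≠ 0 :=
      Nat.cast_ne_zero.2 (Nat.choose_pos (by omega)).ne'
    have h2 : ((d + (e + 1)).choose d : ℝ) ≠ 0 :=
      Nat.cast_ne_zero.2 (Nat.choose_pos (by omega)).ne'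
    have h3 : (e : ℝ) + 1 ≠ 0 := by positivity
    have h4 : ((d + 1 + e + 1 : ℕ) : ℝ) ≠ 0 := by positivity
    rw [show d + (e + 1) + 1 = d + 1 + e + 1 by ring] at h
    rw [eq_div_iff (mul_ne_zero h4 h1)]
    field_simp at h
    refine mul_left_cancel₀ (mul_ne_zero h3 h2) ?_
    linear_combination ((d + 1 + e).choose (d + 1) : ℝ) * h - (-1 : ℝ) ^ d * hch

end Beta

/-! ### The unique solution of the dendriform equation -/

section Solution

variable {k D : Type*} [Field k] [AddCommGroup D] [Module k D]

theorem FormalSeries.cauchy_lam_zero (p : D →ₗ[k] D →ₗ[k] D) (a : D) (x : FormalSeries k D) :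
    (FormalSeries.cauchy p (FormalSeries.lam k a) x).1 0 = 0 :=
  (FormalSeries.cauchy p (FormalSeries.lam k a) x).2

theorem FormalSeries.cauchy_lam_succ (p : D →ₗ[k] D →ₗ[k] D) (a : D) (x : FormalSeries k D)
    (n : ℕ) : (FormalSeries.cauchy p (FormalSeries.lam k a) x).1 (n + 1) = p a (x.1 n) := by
  rw [FormalSeries.cauchy_coeff, Finset.sum_eq_single (1, n)]
  · simp [FormalSeries.lam]
  · rintro ⟨i, j⟩ hij hne
    have : i ≠ 1 := by
      rintro rfl
      rw [Finset.HasAntidiagonal.mem_antidiagonal] at hij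
      exact hne (Prod.ext rfl (by simp only at hij ⊢; omega))
    simp [FormalSeries.lam, this]
  · intro h
    exact absurd (Finset.HasAntidiagonal.mem_antidiagonal.2 (by simp only; omega)) h

variable [Dendriform k D]

variable (k) in
/-- The coefficients `0, a, a ≺ a, a ≺ (a ≺ a), …` of the solution of `X = 𝟏 + λ a ≺ X`. -/
def precIter (a : D) : ℕ → D
  | 0 => 0
  | 1 => a
  | n + 2 => Dendriform.prec (k := k) a (precIter a (n + 1))

/-- Applying `λ a ≺` raises degrees by one, so the equation determines the coefficients recursively.
-/
theorem isSolution_lam_iff (a : D) (X : k × FormalSeries k D) :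
    IsSolution k (FormalSeries.lam k a) X ↔ X = (1, ⟨precIter k a, rfl⟩) := by
  have hcoeff : ∀ (x : FormalSeries k D) (n : ℕ),
      (precAug k (FormalSeries.lam k a) ((1 : k), x)).1 n =
        (FormalSeries.lam k a).1 n
          + (FormalSeries.cauchy Dendriform.prec (FormalSeries.lam k a) x).1 n := by
    intro x n
    change ((1 : k) • (FormalSeries.lam k a).1 n + _) = _
    rw [one_smul]
    rfl
  constructor
  · intro h
    obtain ⟨c, x⟩ := X
    obtain rfl : c = 1 := congrArg Prod.fst h
    have hx : x = precAug k (FormalSeries.lam k a) (1, x) := congrArg Prod.snd h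
    have hn : ∀ n, x.1 n = precIter k a n := by
      intro n
      induction n with
      | zero => exact x.2
      | succ n ih =>
        rw [hx, hcoeff, FormalSeries.cauchy_lam_succ, ih]
        cases n <;> simp [FormalSeries.lam, precIter]
    exact Prod.ext rfl (Subtype.ext (funext hn))
  · rintro rfl
    refine Prod.ext rfl (Subtype.ext (funext fun n => ?_))
    rw [hcoeff]
    match n with
    | 0 => rw [FormalSeries.cauchy_lam_zero]; simp [FormalSeries.lam, precIter]
    | 1 => rw [FormalSeries.cauchy_lam_succ]; simp [FormalSeries.lam, precIter]
    | n + 2 => rw [FormalSeries.cauchy_lam_succ]; simp [FormalSeries.lam, precIter]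

end Solution

/-! ### Generating function of the powers and the logarithm -/

section Dyson

variable {B : Type*} [NormedRing B] [NormedAlgebra ℝ B] [CompleteSpace B]

/-- The coefficients of `𝟏 + λ R(X')`, where `X = 𝟏 + X'` solves `X = 𝟏 + λ a ≺ X`. -/
noncomputable def dyson (a : LocInt B) : ℕ → ℝ → B
  | 0, _ => 1
  | n + 1, t => (R (precIter ℝ a (n + 1))).1 t

theorem continuous_dyson (a : LocInt B) (n : ℕ) : Continuous (dyson a n) := by
  cases n with
  | zero => exact continuous_const
  | succ n => exact R_continuous _

theorem dyson_succ (a : LocInt B) (n : ℕ) (t : ℝ) :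
    dyson a (n + 1) t = ∫ v in (0 : ℝ)..t, a.1 v * dyson a n v := by
  cases n with
  | zero => simp [dyson, precIter, R_apply]
  | succ n => rfl

/-- This is the Rota–Baxter relation in each degree: `R` is multiplicative from `*` to the pointwise
product. -/
theorem R_starPow_succ (x : FormalSeries ℝ (LocInt B)) (m n : ℕ) (s : ℝ) :
    (R ((starPow ℝ x (m + 1)).1 n)).1 s =
      ∑ ij ∈ Finset.HasAntidiagonal.antidiagonal n,
        (R (x.1 ij.1)).1 s * (R ((starPow ℝ x m).1 ij.2)).1 s := by
  have h : (starPow ℝ x (m + 1)).1 n = ∑ ij ∈ Finset.HasAntidiagonal.antidiagonal n,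
      (locPrec (x.1 ij.1) ((starPow ℝ x m).1 ij.2)
        + locSucc (x.1 ij.1) ((starPow ℝ x m).1 ij.2)) := by
    rw [Finset.sum_add_distrib]
    rfl
  simp only [h, map_sum, R_mul_R]
  simp

/-- The coefficient of `λ ^ n` in `∑_m x ^ m R(X ^ {* (m + 1)})(s)`. -/
noncomputable def powerSum (X : FormalSeries ℝ (LocInt B)) (x s : ℝ) (n : ℕ) : B :=
  ∑ m ∈ Finset.range n, x ^ m • (R ((starPow ℝ X m).1 n)).1 s

theorem powerSum_eq_sum_range (X : FormalSeries ℝ (LocInt B)) (x s : ℝ) {n N : ℕ} (h : n ≤ N) :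
    powerSum X x s n = ∑ m ∈ Finset.range N, x ^ m • (R ((starPow ℝ X m).1 n)).1 s := by
  refine Finset.sum_subset (Finset.range_mono h) fun m _ hm => ?_
  rw [FormalSeries.starPow_coeff_eq_zero X m n (by simpa using hm)]
  simp

/-- This is `W = Y + x Y W`, the functional equation of the geometric series, in degree `n`. -/
theorem powerSum_eq (X : FormalSeries ℝ (LocInt B)) (x s : ℝ) (n : ℕ) :
    powerSum X x s n = (R (X.1 n)).1 s + x • ∑ ij ∈ Finset.HasAntidiagonal.antidiagonal n,
      (R (X.1 ij.1)).1 s * powerSum X x s ij.2 := by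
  -- The extra vanishing term in the range leaves `n` terms once `m = 0` is split off.
  rw [powerSum_eq_sum_range X x s n.le_succ, Finset.sum_range_succ']
  simp only [R_starPow_succ, pow_zero, one_smul]
  rw [add_comm]
  congr 1
  simp only [Finset.smul_sum]
  rw [Finset.sum_comm]
  refine Finset.sum_congr rfl fun ij hij => ?_
  rw [powerSum_eq_sum_range X x s 
    (by rw [Finset.HasAntidiagonal.mem_antidiagonal] at hij; omega : ij.2 ≤ n), Finset.mul_sum,
    Finset.smul_sum]
  refine Finset.sum_congr rfl fun m _ => ?_
  rw [mul_smul_comm, smul_smul, pow_succ']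

/-- The solution of the recursion of `eq_integral_chainWeight`. -/
noncomputable def dysonConv (a : LocInt B) (w : ℕ → B) (x : ℝ) (n : ℕ) (t : ℝ) : B :=
  dyson a n t + x • ∑ ij ∈ Finset.HasAntidiagonal.antidiagonal n, dyson a ij.1 t * w ij.2

theorem continuous_dysonConv (a : LocInt B) (w : ℕ → B) (x : ℝ) (n : ℕ) :
    Continuous (dysonConv a w x n) :=
  (continuous_dyson a n).add ((continuous_finsetSum _ fun ij _ =>
    (continuous_dyson a ij.1).mul continuous_const).const_smul x)

theorem integral_mul_dysonConv (a : LocInt B) (w : ℕ → B) (x : ℝ) (n : ℕ) (t : ℝ) :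
    ∫ v in (0 : ℝ)..t, a.1 v * dysonConv a w x n v =
      dyson a (n + 1) t
        + x • ∑ ij ∈ Finset.HasAntidiagonal.antidiagonal n, dyson a (ij.1 + 1) t * w ij.2 := by
  have hint : ∀ i, IntervalIntegrable (fun v => a.1 v * dyson a i v) volume 0 t := fun i =>
    loc_int (locInt_mul_continuous a (continuous_dyson a i)) _ _
  have hmul : ∀ i c, IntervalIntegrable (fun v => a.1 v * dyson a i v * c) volume 0 t :=
    fun i c => (hint i).mul_const c
  simp only [dysonConv, mul_add, mul_smul_comm, Finset.mul_sum, ← mul_assoc]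
  rw [intervalIntegral.integral_add (hint n), intervalIntegral.integral_smul,
    intervalIntegral.integral_finsetSum fun ij _ => hmul _ _, dyson_succ]
  · congr 2
    refine Finset.sum_congr rfl fun ij _ => ?_
    rw [dyson_succ]
    exact ContinuousLinearMap.intervalIntegral_comp_comm
      ((ContinuousLinearMap.mul ℝ B).flip (w ij.2)) (hint ij.1)
  · refine IntervalIntegrable.smul (r := x) ?_
    simpa only [Finset.sum_fn] using IntervalIntegrable.sum
      (Finset.HasAntidiagonal.antidiagonal n) fun ij _ => hmul ij.1 (w ij.2)

/-- This is `W = λ ∫_0^s a P`; the term of `Y W` with first index `0` vanishes because `Y` has no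
constant term. -/
theorem powerSum_precIter_succ (a : LocInt B) (x s : ℝ) (n : ℕ) :
    powerSum ⟨precIter ℝ a, rfl⟩ x s (n + 1) = ∫ v in (0 : ℝ)..s,
      a.1 v * dysonConv a (powerSum ⟨precIter ℝ a, rfl⟩ x s) x n v := by
  rw [integral_mul_dysonConv, powerSum_eq, Finset.Nat.sum_antidiagonal_succ]
  simp [precIter, dyson]

/-- In `F(t) (1 + x W)` the constant term `1` of `F` contributes `x W`, which is the integral up to
`s`; the remaining terms form the integral up to `t`. -/
theorem dysonConv_succ (a : LocInt B) (x s : ℝ) (n : ℕ) (t : ℝ) :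
    dysonConv a (powerSum ⟨precIter ℝ a, rfl⟩ x s) x (n + 1) t =
      (∫ v in (0 : ℝ)..t, a.1 v * dysonConv a (powerSum ⟨precIter ℝ a, rfl⟩ x s) x n v)
        + x • ∫ v in (0 : ℝ)..s,
          a.1 v * dysonConv a (powerSum ⟨precIter ℝ a, rfl⟩ x s) x n v := by
  rw [← powerSum_precIter_succ, integral_mul_dysonConv, dysonConv,
    Finset.Nat.sum_antidiagonal_succ, smul_add]
  simp only [dyson, one_mul]
  abel

/-- The generating function of the powers of the solution, as a sum over permutations. -/
theorem powerSum_precIter_eq_sum_perm (a : LocInt B) (x : ℝ) {s : ℝ} (hs : 0 ≤ s) (n : ℕ) :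
    powerSum ⟨precIter ℝ a, rfl⟩ x s (n + 1) =
      ∑ σ : Equiv.Perm (Fin (n + 1)), (x ^ descents σ * (1 + x) ^ (n - descents σ)) •
        ∫ u in simplex (n + 1) s, orderedProd a.1 σ u := by
  rw [← integral_chainWeight_eq_sum a.2, integral_chainWeight_smul_succ a.2,
    powerSum_precIter_succ, intervalIntegral.integral_of_le hs, integral_Ioc_eq_integral_Ioo]
  refine setIntegral_congr_fun measurableSet_Ioo fun v hv => ?_
  -- The initial condition `P_0 = 1` holds because `W` vanishes in degree `0`, where its defining
  -- sum is empty.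
  rw [eq_integral_chainWeight a.2 x s _ (continuous_dysonConv a _ x)
    (fun t => by simp [dysonConv, dyson, powerSum]) (dysonConv_succ a x s) n ⟨hv.1.le, hv.2.le⟩]

/-- The logarithm is obtained by integrating the generating function of the powers. -/
theorem map_R_logStar (c : ℝ) (X : FormalSeries ℝ (LocInt B)) (n : ℕ) (s : ℝ) :
    ((FormalSeries.map R (FormalSeries.logStar (c, X))).1 n).1 s =
      ∫ x in (-1 : ℝ)..0, powerSum X x s n := by
  simp only [powerSum]
  rw [intervalIntegral.integral_finsetSum fun m _ =>
    ((by fun_prop : Continuous fun x : ℝ => x ^ m • (R ((starPow ℝ X m).1 n)).1 s)).intervalIntegrable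
      _ _]
  simp only [intervalIntegral.integral_smul_const, integral_pow_neg_one_zero]
  simp only [FormalSeries.map, FormalSeries.logStar, map_neg, map_sum, map_smul]
  simp

end Dyson

end Magnus

theorem corollary5p5 {B : Type*} [NormedRing B] [NormedAlgebra ℝ B] [CompleteSpace B]
    (a : Magnus.LocInt B) :
    -- the linear dendriform equation `X = 𝟏 + λ a ≺ X` has exactly one solution
    (∃! X : ℝ × Magnus.FormalSeries ℝ (Magnus.LocInt B),
      Magnus.IsSolution ℝ (Magnus.FormalSeries.lam ℝ a) X) ∧
    -- and `Ω(λ a) = R(Ω'(λ a))`, with `Ω'(λ a) = log^* X`, is given by the stated series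
    ∀ X : ℝ × Magnus.FormalSeries ℝ (Magnus.LocInt B),
      Magnus.IsSolution ℝ (Magnus.FormalSeries.lam ℝ a) X →
      ∀ s : ℝ, 0 < s → ∀ n : ℕ, 0 < n →
        (∀ σ : Equiv.Perm (Fin n),
          MeasureTheory.IntegrableOn (Magnus.orderedProd a.1 σ) (Magnus.simplex n s)
            MeasureTheory.volume) ∧
        ((Magnus.FormalSeries.map Magnus.R (Magnus.FormalSeries.logStar X)).1 n).1 s =
          ∑ σ : Equiv.Perm (Fin n),
            ((-1 : ℝ) ^ Magnus.descents σ /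
                ((n : ℝ) * ((n - 1).choose (Magnus.descents σ) : ℝ))) •
              ∫ u in Magnus.simplex n s, Magnus.orderedProd a.1 σ u := by
  refine ⟨⟨(1, ⟨Magnus.precIter ℝ a, rfl⟩), (Magnus.isSolution_lam_iff a _).2 rfl,
    fun X hX => (Magnus.isSolution_lam_iff a X).1 hX⟩, ?_⟩
  intro X hX s hs n hn
  obtain rfl := (Magnus.isSolution_lam_iff a X).1 hX
  obtain ⟨n, rfl⟩ := Nat.exists_eq_succ_of_ne_zero hn.ne'
  refine ⟨Magnus.integrableOn_orderedProd a.2 s, ?_⟩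
  rw [Magnus.map_R_logStar]
  simp only [Nat.succ_eq_add_one, Magnus.powerSum_precIter_eq_sum_perm a _ hs.le]
  rw [intervalIntegral.integral_finsetSum]
  swap
  · exact fun σ _ => Continuous.intervalIntegrable (by fun_prop) _ _
  refine Finset.sum_congr rfl fun σ _ => ?_
  -- Here `n` is the degree minus one; the exponents `d` and `n - d` add up to `n` because `d ≤ n`.
  rw [intervalIntegral.integral_smul_const, Magnus.integral_pow_mul_one_add_pow,
    Nat.add_sub_cancel' (Magnus.descents_le σ), Nat.add_sub_cancel]
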